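/- Let $L^2=L^2(\mathbb T,dm)$ with $m$ normalized Lebesgue measure on the unit circle, and let $H^2\subset L^2$ be the Hardy space of functions whose negative Fourier coefficients vanish. An inner function is a $u\in H^2$ with $|u|=1$ a.e. on $\mathbb T$ (unimodular constants are allowed). For an inner function $u$ put $K_u=H^2\ominus uH^2$. For $\varphi\in L^\infty(\mathbb T)$ let $T_\varphi f=P_{H^2}(\varphi f)$ be the Toeplitz operator on $H^2$, and let $A^u_\varphi f=P_{K_u}(\varphi f)$ be the truncated Toeplitz operator on $K_u$ with symbol $\varphi$. For a contraction $T$ on a Hilbert space let $D_T=(I-T^*T)^{1/2}$, let $\mathcal D_T$ be the closure of the range of $D_T$, and let $$\Theta_T(\lambda)=\bigl(-T+\lambda D_{T^*}(I-\lambda T^*)^{-1}D_T\bigr)|_{\mathcal D_T}:\ \mathcal D_T\to\mathcal D_{T^*}\qquad(|\lambda|<1)$$ be its Sz.-Nagy--Foias characteristic function. **Theorem.** Let $\theta$ and $B$ be inner functions with $\ker T_{\theta\overline B}=\{0\}$, and let $A=A^\theta_B$, a contraction on $K_\theta$. Then the characteristic function of $A$, viewed as an $\mathcal L(K_B)$-valued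 function, is $$\Phi(\lambda)=A^B_{\frac{\theta}{1-\lambda\overline B}}\qquad(|\lambda|<1).$$ Precisely: there are unitary operators $\omega:\mathcal D_A\to K_B$ and $\omega_*:\mathcal D_{A^*}\to K_B$ which satisfy $$\theta\cdot\omega(D_Ax)=Bx-Ax,\qquad \omega_*(D_{A^*}x)=x-BA^*x\qquad(x\in K_\theta),$$ and $$\Phi(\lambda)\,\omega=\omega_*\,\Theta_A(\lambda)\qquad\text{for all }|\lambda|<1 .$$ In particular $\Theta_A$ and $\Phi$ coincide. -/

import Mathlib

open MeasureTheory
open scoped ENNReal ComplexConjugate InnerProductSpace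

noncomputable section

/-! ### Contractions on a Hilbert space and their characteristic functions -/

section Contractions

variable {H : Type*} [NormedAddCommGroup H] [InnerProductSpace ℂ H] [CompleteSpace H]

/-- The defect operator `D_T = (I - T*T)^{1/2}` of a contraction `T` (positive square root). -/
def defectOp (T : H →L[ℂ] H) : H →L[ℂ] H :=
  CFC.sqrt (1 - ContinuousLinearMap.adjoint T * T)

/-- The defect space of `T`: the closure of the range of `D_T`. -/
def defectSpace (T : H →L[ℂ] H) : Submodule ℂ H :=
  (LinearMap.range (defectOp T : H →ₗ[ℂ] H)).topologicalClosure

instance instCompleteSpaceDefectSpace (T : H →L[ℂ] H) : CompleteSpace (defectSpace T) :=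
  (Submodule.isClosed_topologicalClosure _).completeSpace_coe

theorem defectOp_mem (T : H →L[ℂ] H) (x : H) : defectOp T x ∈ defectSpace T :=
  Submodule.le_topologicalClosure _ ⟨x, rfl⟩

theorem defectOp_mul_self {T : H →L[ℂ] H} (hT : ‖T‖ ≤ 1) :
    defectOp T * defectOp T = 1 - ContinuousLinearMap.adjoint T * T := by
  refine CFC.sqrt_mul_sqrt_self _ ?_
  rw [ContinuousLinearMap.nonneg_iff_isPositive, ContinuousLinearMap.isPositive_def]
  refine ⟨?_, fun x => ?_⟩
  · have h : IsSelfAdjoint (1 - ContinuousLinearMap.adjoint T * T) := by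
      refine (IsSelfAdjoint.one _).sub ?_
      exact IsSelfAdjoint.star_mul_self T
    exact h.isSymmetric
  · have h1 : ‖T x‖ ≤ ‖x‖ := (T.le_of_opNorm_le hT x).trans (one_mul _).le
    have h2 : ‖T x‖ ^ 2 ≤ ‖x‖ ^ 2 := by gcongr
    simp only [ContinuousLinearMap.reApplyInnerSelf, sub_apply,
      one_apply_eq_self, mul_apply_eq_comp, inner_sub_left,
      ContinuousLinearMap.adjoint_inner_left, inner_self_eq_norm_sq_to_K, map_sub]
    norm_cast
    linarith

theorem defectOp_isSymmetric (T : H →L[ℂ] H) (x y : H) :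
    inner ℂ (defectOp T x) y = inner ℂ x (defectOp T y) := by
  have h : IsSelfAdjoint (defectOp T) := IsSelfAdjoint.of_nonneg (CFC.sqrt_nonneg _)
  exact h.isSymmetric x y

/-- A contraction `T` maps its defect space into the defect space of `T*`. -/
theorem map_defectSpace {T : H →L[ℂ] H} (hT : ‖T‖ ≤ 1) {x : H} (hx : x ∈ defectSpace T) :
    T x ∈ defectSpace (ContinuousLinearMap.adjoint T) := by
  have hT' : ‖ContinuousLinearMap.adjoint T‖ ≤ 1 := by
    rwa [LinearIsometryEquiv.norm_map]
  set R : Submodule ℂ H :=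
    (LinearMap.range ((defectOp T * defectOp T : H →L[ℂ] H) : H →ₗ[ℂ] H)).topologicalClosure
    with hR
  have : CompleteSpace R := (Submodule.isClosed_topologicalClosure _).completeSpace_coe
  have hsub : R ≤ (defectSpace (ContinuousLinearMap.adjoint T)).comap (T : H →ₗ[ℂ] H) := by
    refine Submodule.topologicalClosure_minimal _ ?_ ?_
    · rintro _ ⟨y, rfl⟩
      have : T ((defectOp T * defectOp T) y) =
          defectOp (ContinuousLinearMap.adjoint T)
            (defectOp (ContinuousLinearMap.adjoint T) (T y)) := by
        rw [← mul_apply_eq_comp (defectOp (ContinuousLinearMap.adjoint T)),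
          defectOp_mul_self hT, defectOp_mul_self hT']
        simp
      change T ((defectOp T * defectOp T) y) ∈ defectSpace (ContinuousLinearMap.adjoint T)
      rw [this]
      exact defectOp_mem _ _
    · exact (Submodule.isClosed_topologicalClosure _).preimage T.continuous
  have hle : defectSpace T ≤ R := by
    refine Submodule.topologicalClosure_minimal _ ?_ (Submodule.isClosed_topologicalClosure _)
    rintro _ ⟨y, rfl⟩
    rw [← Submodule.orthogonal_orthogonal R, Submodule.mem_orthogonal]
    intro u hu
    have h0 : inner ℂ (defectOp T (defectOp T u)) u = 0 :=
      (Submodule.mem_orthogonal _ _).1 hu _ (Submodule.le_topologicalClosure _ ⟨u, rfl⟩)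
    rw [defectOp_isSymmetric] at h0
    have h1 : defectOp T u = 0 := inner_self_eq_zero.1 h0
    change inner ℂ u (defectOp T y) = 0
    rw [← defectOp_isSymmetric, h1, inner_zero_left]
  exact hsub (hle hx)

/-- The Sz.-Nagy--Foias characteristic function of a contraction `T`,
`Θ_T(z) = -T + z D_{T*} (I - z T*)⁻¹ D_T`, as an operator from the defect space of `T` to the
defect space of `T*`. For `|z| < 1` the operator `I - z T*` is invertible. -/
def characteristicFunction (T : H →L[ℂ] H) (hT : ‖T‖ ≤ 1) (z : ℂ) :
    defectSpace T →L[ℂ] defectSpace (ContinuousLinearMap.adjoint T) :=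
  ((-T + z • (defectOp (ContinuousLinearMap.adjoint T) *
      Ring.inverse (1 - z • ContinuousLinearMap.adjoint T) * defectOp T)) ∘L
      (defectSpace T).subtypeL).codRestrict (defectSpace (ContinuousLinearMap.adjoint T))
    (fun v => Submodule.add_mem _ (Submodule.neg_mem _ (map_defectSpace hT v.2))
      (Submodule.smul_mem _ _ (defectOp_mem _ _)))

theorem isUnit_one_sub_smul_adjoint {T : H →L[ℂ] H} (hT : ‖T‖ ≤ 1) {z : ℂ} (hz : ‖z‖ < 1) :
    IsUnit (1 - z • ContinuousLinearMap.adjoint T) := by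
  refine isUnit_one_sub_of_norm_lt_one ?_
  rw [norm_smul, LinearIsometryEquiv.norm_map]
  nlinarith [norm_nonneg z, norm_nonneg T]

/-- The compression `P_K S|K` of an operator `S` to a closed subspace `K`. -/
def compression (K : Submodule ℂ H) [CompleteSpace K] (S : H →L[ℂ] H) : K →L[ℂ] K :=
  K.orthogonalProjectionOnto ∘L S ∘L K.subtypeL

theorem norm_compression_le (K : Submodule ℂ H) [CompleteSpace K] (S : H →L[ℂ] H) :
    ‖compression K S‖ ≤ ‖S‖ := by
  refine ContinuousLinearMap.opNorm_le_bound _ (norm_nonneg _) fun x => ?_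
  calc ‖K.orthogonalProjectionOnto (S x)‖ ≤ ‖S x‖ := K.norm_orthogonalProjectionOnto_apply_le _
    _ ≤ ‖S‖ * ‖x‖ := S.le_opNorm x

end Contractions

/-! ### Hardy space, inner functions, model spaces, truncated Toeplitz operators -/

/-- The unit circle, parametrized by `t ↦ e^{it}`. -/
abbrev Torus : Type := AddCircle (2 * Real.pi)

instance instFactTwoPiPos : Fact (0 < 2 * Real.pi) := ⟨Real.two_pi_pos⟩

/-- Normalized Lebesgue measure on the circle. -/
abbrev circleMeasure : Measure Torus := AddCircle.haarAddCircle

/-- `L²` of the circle. -/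
abbrev L2T : Type := Lp ℂ 2 circleMeasure

/-- `L^∞` of the circle. -/
abbrev LinfT : Type := Lp ℂ ∞ circleMeasure

/-- The Hardy space `H²`, as a subspace of `L²`. -/
def hardySpace : Submodule ℂ L2T where
  carrier := {f | ∀ n : ℤ, n < 0 → fourierCoeff f n = 0}
  add_mem' := by
    intro f g hf hg n hn
    rw [← fourierBasis_repr, map_add, lp.coeFn_add, Pi.add_apply, fourierBasis_repr,
      fourierBasis_repr, hf n hn, hg n hn, add_zero]
  zero_mem' := by
    intro n _
    rw [← fourierBasis_repr, map_zero]
    rfl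
  smul_mem' := by
    intro c f hf n hn
    rw [← fourierBasis_repr, map_smul, lp.coeFn_smul, Pi.smul_apply, fourierBasis_repr, hf n hn,
      smul_zero]

theorem isClosed_hardySpace : IsClosed (hardySpace : Set L2T) := by
  have h : (hardySpace : Set L2T) =
      ⋂ n : ℤ, ⋂ _ : n < 0, {f : L2T | inner ℂ (fourierBasis n) f = (0 : ℂ)} := by
    ext f
    simp only [Set.mem_iInter, Set.mem_ofPred_eq, ← HilbertBasis.repr_apply_apply,
      fourierBasis_repr]
    rfl
  rw [h]
  exact isClosed_iInter fun n => isClosed_iInter fun _ =>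
    isClosed_eq (continuous_const.inner continuous_id) continuous_const

instance instCompleteSpaceHardySpace : CompleteSpace hardySpace :=
  isClosed_hardySpace.completeSpace_coe

/-- `φ` is (the boundary function of) an inner function: its negative Fourier coefficients vanish
and its values have modulus `1` almost everywhere. Unimodular constants are allowed. -/
structure IsInner (φ : LinfT) : Prop where
  fourierCoeff_eq_zero : ∀ n : ℤ, n < 0 → fourierCoeff φ n = 0
  norm_eq_one : ∀ᵐ t ∂circleMeasure, ‖φ t‖ = 1

/-- Multiplication by `φ ∈ L^∞` on `L²`. -/
def mulOp (φ : LinfT) : L2T →L[ℂ] L2T :=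
  (ContinuousLinearMap.mul ℂ ℂ).holderL circleMeasure ∞ 2 2 φ

theorem coeFn_mulOp (φ : LinfT) (f : L2T) :
    mulOp φ f =ᵐ[circleMeasure] fun t => φ t * f t :=
  (ContinuousLinearMap.mul ℂ ℂ).coeFn_holder φ f

theorem norm_mulOp_apply {φ : LinfT} (hφ : IsInner φ) (f : L2T) : ‖mulOp φ f‖ = ‖f‖ := by
  rw [Lp.norm_def, Lp.norm_def]
  congr 1
  refine eLpNorm_congr_norm_ae ?_
  filter_upwards [coeFn_mulOp φ f, hφ.norm_eq_one] with t h1 h2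
  rw [h1, norm_mul, h2, one_mul]

/-- The model space `K_θ = H² ⊖ θH²`. -/
def modelSpace (θ : LinfT) : Submodule ℂ L2T :=
  hardySpace ⊓ (hardySpace.map (mulOp θ : L2T →ₗ[ℂ] L2T))ᗮ

instance instCompleteSpaceModelSpace (θ : LinfT) : CompleteSpace (modelSpace θ) :=
  (isClosed_hardySpace.inter (Submodule.isClosed_orthogonal _)).completeSpace_coe

/-- The Toeplitz operator `T_φ` on `H²`. -/
def toeplitz (φ : LinfT) : hardySpace →L[ℂ] hardySpace :=
  compression hardySpace (mulOp φ)

/-- The truncated Toeplitz operator `A^θ_φ` on `K_θ` with symbol `φ`. -/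
def truncatedToeplitz (θ φ : LinfT) : modelSpace θ →L[ℂ] modelSpace θ :=
  compression (modelSpace θ) (mulOp φ)

theorem norm_truncatedToeplitz_le_one (θ : LinfT) {B : LinfT} (hB : IsInner B) :
    ‖truncatedToeplitz θ B‖ ≤ 1 :=
  (norm_compression_le _ _).trans <|
    ContinuousLinearMap.opNorm_le_bound _ zero_le_one fun f => by
      rw [norm_mulOp_apply hB, one_mul]

theorem memLp_mul_conj {θ B : LinfT} (hθ : IsInner θ) (hB : IsInner B) :
    MemLp (fun t => θ t * conj (B t)) ∞ circleMeasure := by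
  refine memLp_top_of_bound ?_ 1 ?_
  · exact (Lp.aestronglyMeasurable θ).mul
      (Complex.continuous_conj.comp_aestronglyMeasurable (Lp.aestronglyMeasurable B))
  · filter_upwards [hθ.norm_eq_one, hB.norm_eq_one] with t h1 h2
    rw [norm_mul, RCLike.norm_conj, h1, h2, one_mul]

/-- The function `θ B̄` on the circle. -/
def mulConj {θ B : LinfT} (hθ : IsInner θ) (hB : IsInner B) : LinfT :=
  (memLp_mul_conj hθ hB).toLp (fun t => θ t * conj (B t))

theorem memLp_charSymbol {θ B : LinfT} (hθ : IsInner θ) (hB : IsInner B) {z : ℂ} (hz : ‖z‖ < 1) :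
    MemLp (fun t => θ t / (1 - z * conj (B t))) ∞ circleMeasure := by
  refine memLp_top_of_bound ?_ (1 / (1 - ‖z‖)) ?_
  · exact ((Lp.aestronglyMeasurable θ).aemeasurable.div (aemeasurable_const.sub
      (aemeasurable_const.mul (Complex.continuous_conj.comp_aestronglyMeasurable
        (Lp.aestronglyMeasurable B)).aemeasurable))).aestronglyMeasurable
  · filter_upwards [hθ.norm_eq_one, hB.norm_eq_one] with t h1 h2
    rw [norm_div, h1]
    have h3 : 1 - ‖z‖ ≤ ‖1 - z * conj (B t)‖ := by
      have := norm_sub_norm_le (1 : ℂ) (z * conj (B t))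
      rwa [norm_mul, RCLike.norm_conj, h2, mul_one, norm_one] at this
    exact one_div_le_one_div_of_le (by linarith) h3

/-- The function `θ / (1 - z B̄)` on the circle, for `|z| < 1`. -/
def charSymbol {θ B : LinfT} (hθ : IsInner θ) (hB : IsInner B) (z : ℂ) (hz : ‖z‖ < 1) : LinfT :=
  (memLp_charSymbol hθ hB hz).toLp (fun t => θ t / (1 - z * conj (B t)))

end

/-! Write `A` for `A^θ_B`. Since `A x` is the projection of `B x` to `K_θ`, the function `B x - A x`
lies in `H²` and is orthogonal to `K_θ`, hence equals `θ g`; one checks `g ∈ K_B`, and Pythagoras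
gives `‖g‖² = ‖x‖² - ‖A x‖² = ‖D_A x‖²`. Likewise `A* x = P_{H²}(B̄ x)`, so `x - B A* x` lies in
`K_B` and has the norm of `D_{A*} x`. Thus both formulas define isometries from the defect spaces
into `K_B`. Injectivity of `T_{θB̄}` is what makes their ranges dense, so that they extend to
unitaries.

For the characteristic function, `T D_T = D_{T*} T` gives `Θ_A(z) D_A x = D_{A*} u` with `(I - z A*)
u = (z - A) x`. It remains to see that `θ g / (1 - z B̄)` and `u - B A* u` have the same projection
to `K_B`. Multiplied by `1 - z B̄`, the function `θ g / (1 - z B̄) - u - B x` becomes `z (B̄ u - A*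
u) ∈ (H²)ᗮ`, and this factor can be cancelled modulo `(H²)ᗮ`. What is left over, `B (x + A* u)`, is
in `B H²` and so orthogonal to `K_B`. Density of the vectors `D_A x` finishes the proof. -/

/-! ### Defect operators -/

section Defect

variable {H : Type*} [NormedAddCommGroup H] [InnerProductSpace ℂ H] [CompleteSpace H]

/-- If `a x = -x b` with `a` and `b` nonnegative, then `x b = 0`. -/
theorem mul_eq_zero_of_mul_eq_neg_mul {a b x : H →L[ℂ] H} (ha : 0 ≤ a) (hb : 0 ≤ b)
    (h : a * x = -(x * b)) : x * b = 0 := by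
  have hsb : star b = b := IsSelfAdjoint.of_nonneg hb
  have h1 : star x * a * x = -(star x * x * b) := by
    rw [mul_assoc, h, mul_neg, mul_assoc]
  have h2 : 0 ≤ star x * a * x := star_left_conjugate_nonneg ha x
  -- `x* a x` is self-adjoint; comparing `x* x b` with its adjoint `b x* x` gives the commutation.
  have h3 : Commute (star x * x) b := by
    have h4 : star (star x * a * x) = star x * a * x := IsSelfAdjoint.of_nonneg h2
    rw [h1] at h4
    simp only [star_neg, star_mul, star_star, hsb, neg_inj] at h4
    exact h4.symm
  have h5 : 0 ≤ star x * x * b := Commute.mul_nonneg (star_mul_self_nonneg x) hb h3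
  have h6 : star x * x * b = 0 := le_antisymm (by rw [h1] at h2; simpa using h2) h5
  have h7 : star (x * b) * (x * b) = 0 := by
    rw [star_mul, mul_assoc, ← mul_assoc (star x), h6, mul_zero]
  exact CStarRing.star_mul_self_eq_zero_iff _ |>.1 h7

/-- The defect operators of a contraction `T` are intertwined by `T`. -/
theorem mul_defectOp {T : H →L[ℂ] H} (hT : ‖T‖ ≤ 1) :
    T * defectOp T = defectOp (ContinuousLinearMap.adjoint T) * T := by
  have hT' : ‖ContinuousLinearMap.adjoint T‖ ≤ 1 := by
    rwa [LinearIsometryEquiv.norm_map]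
  set a := defectOp (ContinuousLinearMap.adjoint T) with ha
  set b := defectOp T with hb
  have ha0 : 0 ≤ a := CFC.sqrt_nonneg _
  have hb0 : 0 ≤ b := CFC.sqrt_nonneg _
  have hsb : star b = b := IsSelfAdjoint.of_nonneg hb0
  have hsa : star a = a := IsSelfAdjoint.of_nonneg ha0
  have haa : a * a = 1 - T * ContinuousLinearMap.adjoint T := by
    rw [ha, defectOp_mul_self hT', ContinuousLinearMap.adjoint_adjoint]
  have hbb : b * b = 1 - ContinuousLinearMap.adjoint T * T := defectOp_mul_self hT
  have h0 : a * a * T = T * (b * b) := by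
    rw [haa, hbb]; noncomm_ring
  -- From `a² T = T b²` one gets `a x + x b = 0`. With `a, b ≥ 0` this forces `x b = 0 = a x`,
  -- whence `(x* x)² = 0`. No functional calculus for polynomials in `T* T` is needed.
  set x := T * b - a * T with hx
  have h1 : a * x = -(x * b) := by
    have : a * x + x * b = T * (b * b) - a * a * T := by rw [hx]; noncomm_ring
    rw [h0, sub_self] at this
    exact eq_neg_of_add_eq_zero_left this
  have h2 : x * b = 0 := mul_eq_zero_of_mul_eq_neg_mul ha0 hb0 h1
  have h3 : a * x = 0 := by rw [h1, h2, neg_zero]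
  have h4 : star x * a = 0 := by
    have := congrArg star h3
    simpa [hsa] using this
  have h5 : star x * x = star x * T * b := by
    rw [hx, mul_sub, ← hx, ← mul_assoc, ← mul_assoc, h4, zero_mul, sub_zero]
  have h6 : b * star x = 0 := by
    have := congrArg star h2
    simpa [hsb] using this
  have h7 : (star x * x) * star (star x * x) = 0 := by
    rw [star_mul, star_star]
    nth_rewrite 1 [h5]
    rw [mul_assoc, ← mul_assoc b, h6, zero_mul, mul_zero]
  have h8 : star x * x = 0 := CStarRing.mul_star_self_eq_zero_iff _ |>.1 h7
  exact sub_eq_zero.1 (CStarRing.star_mul_self_eq_zero_iff _ |>.1 h8)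

theorem norm_defectOp_sq {T : H →L[ℂ] H} (hT : ‖T‖ ≤ 1) (x : H) :
    ‖defectOp T x‖ ^ 2 = ‖x‖ ^ 2 - ‖T x‖ ^ 2 := by
  have h : inner ℂ (defectOp T x) (defectOp T x) = inner ℂ x x - inner ℂ (T x) (T x) := by
    rw [defectOp_isSymmetric, ← mul_apply_eq_comp, defectOp_mul_self hT]
    simp [ContinuousLinearMap.adjoint_inner_right]
  simp only [inner_self_eq_norm_sq_to_K] at h
  exact_mod_cast h

theorem denseRange_defectOp (T : H →L[ℂ] H) :
    DenseRange fun x => (⟨defectOp T x, defectOp_mem T x⟩ : defectSpace T) := by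
  rw [DenseRange, Subtype.dense_iff]
  intro x hx
  have : Subtype.val '' Set.range
      (fun x => (⟨defectOp T x, defectOp_mem T x⟩ : defectSpace T)) = Set.range (defectOp T) := by
    rw [← Set.range_comp]; rfl
  exact this.symm ▸ hx

/-- A linear map which has the same norms as `D_T` and whose range is dense factors as `ω ∘ D_T`
with `ω` unitary. -/
theorem exists_isometryEquiv_defectSpace {F : Type*} [NormedAddCommGroup F]
    [InnerProductSpace ℂ F] [CompleteSpace F] (T : H →L[ℂ] H) (hT : ‖T‖ ≤ 1) (L : H →ₗ[ℂ] F)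
    (hL : ∀ x, ‖L x‖ ^ 2 = ‖x‖ ^ 2 - ‖T x‖ ^ 2)
    (hd : (LinearMap.range L)ᗮ = ⊥) :
    ∃ ω : defectSpace T ≃ₗᵢ[ℂ] F, ∀ x, ω ⟨defectOp T x, defectOp_mem T x⟩ = L x := by
  let e : H →ₗ[ℂ] defectSpace T :=
    (defectOp T : H →ₗ[ℂ] H).codRestrict (defectSpace T) (defectOp_mem T)
  have he : DenseRange e := denseRange_defectOp T
  have hL' : DenseRange L := by
    have := (Submodule.topologicalClosure_eq_top_iff).2 hd
    exact Submodule.dense_iff_topologicalClosure_eq_top.2 this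
  have hn : ∀ x, ‖L (LinearEquiv.refl ℂ H x)‖ = ‖e x‖ := fun x => by
    rw [← sq_eq_sq₀ (norm_nonneg _) (norm_nonneg _)]
    exact (hL x).trans (norm_defectOp_sq hT x).symm
  exact ⟨(LinearEquiv.refl ℂ H).extendOfIsometry e L he hL' hn,
    fun x => LinearEquiv.extendOfIsometry_eq _ _ _ he hL' hn x⟩

/-- `Θ_T(z) D_T x = D_{T*} u` where `u = (I - z T*)⁻¹ (z - T) x`. -/
theorem characteristicFunction_defectOp {T : H →L[ℂ] H} (hT : ‖T‖ ≤ 1) {z : ℂ} (hz : ‖z‖ < 1)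
    (x : H) : ∃ u : H, u - z • ContinuousLinearMap.adjoint T u = z • x - T x ∧
      characteristicFunction T hT z ⟨defectOp T x, defectOp_mem T x⟩ =
        ⟨defectOp (ContinuousLinearMap.adjoint T) u, defectOp_mem _ u⟩ := by
  set y := Ring.inverse (1 - z • ContinuousLinearMap.adjoint T) (defectOp T (defectOp T x)) with hy
  have hdd : defectOp T (defectOp T x) = x - ContinuousLinearMap.adjoint T (T x) := by
    rw [← mul_apply_eq_comp, defectOp_mul_self hT]; simp
  have hy1 : y - z • ContinuousLinearMap.adjoint T y = x - ContinuousLinearMap.adjoint T (T x) := by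
    have := congrArg (fun S : H →L[ℂ] H => S (defectOp T (defectOp T x)))
      (Ring.mul_inverse_cancel _ (isUnit_one_sub_smul_adjoint hT hz))
    rw [← hdd]
    simpa using this
  -- Pulling `D_{T*}` out of `-T D_T x + z D_{T*} y`, by means of `T D_T = D_{T*} T`, leaves this
  -- vector.
  refine ⟨z • y - T x, ?_, ?_⟩
  · have : z • x = z • (y - z • ContinuousLinearMap.adjoint T y) +
        z • ContinuousLinearMap.adjoint T (T x) := by rw [hy1]; module
    rw [this, map_sub, map_smul]
    module
  · ext
    have h := congrArg (fun S : H →L[ℂ] H => S x) (mul_defectOp hT)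
    simp only [mul_apply_eq_comp] at h
    change -T (defectOp T x) + z • defectOp (ContinuousLinearMap.adjoint T) y =
      defectOp (ContinuousLinearMap.adjoint T) (z • y - T x)
    rw [h, map_sub, map_smul]
    abel

theorem adjoint_compression (K : Submodule ℂ H) [CompleteSpace K] (S : H →L[ℂ] H) :
    ContinuousLinearMap.adjoint (compression K S) =
      compression K (ContinuousLinearMap.adjoint S) := by
  simp only [compression, ContinuousLinearMap.adjoint_comp, Submodule.adjoint_subtypeL,
    Submodule.adjoint_orthogonalProjectionOnto, ContinuousLinearMap.comp_assoc]

end Defect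

/-! ### Multiplication operators and the Hardy space -/

section Hardy

theorem mulOp_comm (φ ψ : LinfT) (f : L2T) : mulOp φ (mulOp ψ f) = mulOp ψ (mulOp φ f) := by
  refine Lp.ext ?_
  filter_upwards [coeFn_mulOp φ (mulOp ψ f), coeFn_mulOp ψ (mulOp φ f), coeFn_mulOp φ f,
    coeFn_mulOp ψ f] with t h1 h2 h3 h4
  rw [h1, h2, h3, h4]
  ring

theorem mulOp_star_mulOp {φ : LinfT} (hφ : IsInner φ) (f : L2T) :
    mulOp (star φ) (mulOp φ f) = f := by
  refine Lp.ext ?_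
  filter_upwards [coeFn_mulOp (star φ) (mulOp φ f), coeFn_mulOp φ f, Lp.coeFn_star φ,
    hφ.norm_eq_one] with t h1 h2 h3 h4
  rw [h1, h2, h3, Pi.star_apply, ← mul_assoc]
  have : star (φ t) * φ t = 1 := by
    rw [mul_comm]
    exact (Complex.mul_conj' _).trans (by simp [h4])
  rw [this, one_mul]

theorem mulOp_mulOp_star {φ : LinfT} (hφ : IsInner φ) (f : L2T) :
    mulOp φ (mulOp (star φ) f) = f := by
  rw [mulOp_comm, mulOp_star_mulOp hφ]

theorem adjoint_mulOp (φ : LinfT) :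
    ContinuousLinearMap.adjoint (mulOp φ) = mulOp (star φ) := by
  symm
  rw [ContinuousLinearMap.eq_adjoint_iff]
  intro f g
  rw [L2.inner_def, L2.inner_def]
  refine integral_congr_ae ?_
  filter_upwards [coeFn_mulOp (star φ) f, coeFn_mulOp φ g, Lp.coeFn_star φ] with t h1 h2 h3
  rw [h1, h2, h3]
  simp only [Pi.star_apply, RCLike.inner_apply', map_mul, starRingEnd_apply, star_star]
  ring

theorem inner_mulOp_left (φ : LinfT) (f g : L2T) :
    inner ℂ (mulOp φ f) g = inner ℂ f (mulOp (star φ) g) := by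
  rw [← adjoint_mulOp, ContinuousLinearMap.adjoint_inner_right]

theorem inner_mulOp_right (φ : LinfT) (f g : L2T) :
    inner ℂ f (mulOp φ g) = inner ℂ (mulOp (star φ) f) g := by
  rw [← adjoint_mulOp, ContinuousLinearMap.adjoint_inner_left]

theorem mulOp_mulConj {θ B : LinfT} (hθ : IsInner θ) (hB : IsInner B) (f : L2T) :
    mulOp (mulConj hθ hB) f = mulOp θ (mulOp (star B) f) := by
  refine Lp.ext ?_
  filter_upwards [coeFn_mulOp (mulConj hθ hB) f, coeFn_mulOp θ (mulOp (star B) f),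
    coeFn_mulOp (star B) f, Lp.coeFn_star B, (memLp_mul_conj hθ hB).coeFn_toLp] with t h1 h2 h3 h4 h5
  rw [h1, h2, h3, h4, mulConj, h5, mul_assoc]
  rfl

/-- The only property of the symbol `θ / (1 - z B̄)` that the final computation uses; the
denominator does not vanish because `|z B̄| = |z| < 1` almost everywhere. -/
theorem mulOp_charSymbol_sub {θ B : LinfT} (hθ : IsInner θ) (hB : IsInner B) {z : ℂ}
    (hz : ‖z‖ < 1) (f : L2T) :
    mulOp (charSymbol hθ hB z hz) f - z • mulOp (star B) (mulOp (charSymbol hθ hB z hz) f) =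
      mulOp θ f := by
  refine Lp.ext ?_
  set q := mulOp (charSymbol hθ hB z hz) f with hq
  filter_upwards [coeFn_mulOp (charSymbol hθ hB z hz) f, coeFn_mulOp θ f,
    coeFn_mulOp (star B) q, Lp.coeFn_star B, (memLp_charSymbol hθ hB hz).coeFn_toLp,
    Lp.coeFn_sub q (z • mulOp (star B) q), Lp.coeFn_smul z (mulOp (star B) q),
    hB.norm_eq_one] with t h1 h2 h3 h4 h5 h6 h7 h8
  rw [h6, Pi.sub_apply, h7, Pi.smul_apply, h3, h4, h1, h2, charSymbol, h5, smul_eq_mul]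
  have hne : 1 - z * conj (B t) ≠ 0 := by
    intro h0
    have : ‖z * conj (B t)‖ = 1 := by rw [← sub_eq_zero.1 h0, norm_one]
    rw [norm_mul, RCLike.norm_conj, h8, mul_one] at this
    exact hz.ne this
  change θ t / (1 - z * conj (B t)) * f t -
    z * (conj (B t) * (θ t / (1 - z * conj (B t)) * f t)) = θ t * f t
  field_simp

/-- An inner function multiplies `H²` into `H²`. -/
theorem mulOp_mem_hardySpace {φ : LinfT} (hφ : IsInner φ) {f : L2T} (hf : f ∈ hardySpace) :
    mulOp φ f ∈ hardySpace := by
  -- On exponentials the `n`-th coefficient of `φ e_m` is the `(n - m)`-th of `φ`; Fourier series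
  -- and closedness of `H²` do the rest.
  have h1 : ∀ m : ℤ, 0 ≤ m → mulOp φ (fourierLp 2 m) ∈ hardySpace := by
    intro m hm n hn
    rw [← hφ.fourierCoeff_eq_zero (n - m) (by omega), fourierCoeff, fourierCoeff]
    refine integral_congr_ae ?_
    filter_upwards [coeFn_mulOp φ (fourierLp 2 m), coeFn_fourierLp (T := 2 * Real.pi) 2 m]
      with t h1 h2
    rw [h1, h2, smul_eq_mul, smul_eq_mul, show -(n - m) = -n + m by ring, fourier_add]
    ring
  have h2 := (hasSum_fourier_series_L2 f).mapL (mulOp φ)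
  refine isClosed_hardySpace.mem_of_tendsto h2 (Filter.Eventually.of_forall fun s => ?_)
  refine Submodule.sum_mem _ fun m _ => ?_
  rw [map_smul]
  rcases lt_or_ge m 0 with hm | hm
  · rw [hf m hm, zero_smul]
    exact Submodule.zero_mem _
  · exact Submodule.smul_mem _ _ (h1 m hm)

/-- The conjugate of an inner function multiplies `(H²)ᗮ` into `(H²)ᗮ`. -/
theorem mulOp_star_mem_orthogonal {φ : LinfT} (hφ : IsInner φ) {f : L2T}
    (hf : f ∈ hardySpaceᗮ) : mulOp (star φ) f ∈ hardySpaceᗮ := by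
  rw [Submodule.mem_orthogonal] at hf ⊢
  intro h hh
  rw [inner_mulOp_right, star_star]
  exact hf _ (mulOp_mem_hardySpace hφ hh)

/-- Multiplication by `1 - z φ̄` is injective modulo `(H²)ᗮ`. -/
theorem mem_orthogonal_of_sub_smul_mem {φ : LinfT} (hφ : IsInner φ) {z : ℂ} (hz : ‖z‖ < 1)
    {r : L2T} (hr : r - z • mulOp (star φ) r ∈ hardySpaceᗮ) : r ∈ hardySpaceᗮ := by
  set P := (hardySpace : Submodule ℂ L2T).starProjection with hP
  have h0 : ∀ k ∈ hardySpaceᗮ, P k = 0 := fun k hk => by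
    rw [hP]; exact (Submodule.starProjection_apply_eq_zero_iff _).2 hk
  -- `φ̄` preserves `(H²)ᗮ`, so `r` may be replaced by `P r` inside. Then `P r` is fixed by a linear
  -- map of norm at most `|z| < 1`.
  have h1 : P r = z • P (mulOp (star φ) (P r)) := by
    have ha := h0 _ hr
    have hb := h0 _ (mulOp_star_mem_orthogonal hφ
      (Submodule.sub_starProjection_mem_orthogonal (K := hardySpace) r))
    rw [map_sub, map_smul] at ha
    rw [← hP, map_sub, map_sub] at hb
    rw [← sub_eq_zero.1 hb]
    exact sub_eq_zero.1 ha
  have h2 : ‖P r‖ ≤ ‖z‖ * ‖P r‖ := by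
    calc ‖P r‖ = ‖z‖ * ‖P (mulOp (star φ) (P r))‖ := by
          conv_lhs => rw [h1, norm_smul]
      _ ≤ ‖z‖ * ‖mulOp (star φ) (P r)‖ := by
          gcongr
          exact Submodule.norm_starProjection_apply_le _ _
      _ = ‖z‖ * ‖P r‖ := by
          rw [← norm_mulOp_apply hφ (mulOp (star φ) (P r)), mulOp_mulOp_star hφ]
  have h3 : P r = 0 := by
    by_contra hne
    have := norm_pos_iff.2 hne
    nlinarith
  exact (Submodule.starProjection_apply_eq_zero_iff _).1 h3

/-- Orthogonality to `θ H²` is moved across the inner product by the adjoint `θ̄`; membership in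
model spaces is checked in this form below. -/
theorem mem_modelSpace_iff {θ : LinfT} {f : L2T} :
    f ∈ modelSpace θ ↔ f ∈ hardySpace ∧ mulOp (star θ) f ∈ hardySpaceᗮ := by
  rw [modelSpace, Submodule.mem_inf]
  refine and_congr_right fun _ => ?_
  rw [Submodule.mem_orthogonal, Submodule.mem_orthogonal]
  constructor
  · intro h u hu
    rw [inner_mulOp_right, star_star]
    exact h _ ⟨u, hu, rfl⟩
  · rintro h _ ⟨u, hu, rfl⟩
    change inner ℂ (mulOp θ u) f = 0
    rw [inner_mulOp_left]
    exact h u hu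

theorem mulOp_mem_orthogonal_modelSpace {θ : LinfT} {h : L2T} (hh : h ∈ hardySpace) :
    mulOp θ h ∈ (modelSpace θ)ᗮ := by
  rw [Submodule.mem_orthogonal']
  intro f hf
  rw [inner_mulOp_left]
  exact (Submodule.mem_orthogonal _ _).1 (mem_modelSpace_iff.1 hf).2 _ hh

theorem orthogonal_hardySpace_le (θ : LinfT) : hardySpaceᗮ ≤ (modelSpace θ)ᗮ :=
  Submodule.orthogonal_le inf_le_left

/-- An element of `H²` orthogonal to `K_θ` is divisible by `θ`. -/
theorem exists_mulOp_eq_of_mem_orthogonal {θ : LinfT} (hθ : IsInner θ) {f : L2T}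
    (hf : f ∈ hardySpace) (h : f ∈ (modelSpace θ)ᗮ) : ∃ g ∈ hardySpace, mulOp θ g = f := by
  set g := (hardySpace : Submodule ℂ L2T).starProjection (mulOp (star θ) f) with hg
  have hgm : g ∈ hardySpace := Submodule.starProjection_apply_mem _ _
  refine ⟨g, hgm, ?_⟩
  have hd : f - mulOp θ g ∈ modelSpace θ := by
    rw [mem_modelSpace_iff]
    refine ⟨Submodule.sub_mem _ hf (mulOp_mem_hardySpace hθ hgm), ?_⟩
    rw [map_sub, mulOp_star_mulOp hθ]
    exact Submodule.sub_starProjection_mem_orthogonal _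
  have hd' : f - mulOp θ g ∈ (modelSpace θ)ᗮ :=
    Submodule.sub_mem _ h (mulOp_mem_orthogonal_modelSpace hgm)
  exact (sub_eq_zero.1 (inner_self_eq_zero.1 ((Submodule.mem_orthogonal _ _).1 hd' _ hd))).symm

theorem eq_zero_of_ker_toeplitz_mulConj {θ B : LinfT} (hθ : IsInner θ) (hB : IsInner B)
    (hker : LinearMap.ker (toeplitz (mulConj hθ hB) : hardySpace →ₗ[ℂ] hardySpace) = ⊥)
    {g : L2T} (hg : g ∈ hardySpace) (h : mulOp θ (mulOp (star B) g) ∈ hardySpaceᗮ) : g = 0 := by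
  have : (⟨g, hg⟩ : hardySpace) ∈
      LinearMap.ker (toeplitz (mulConj hθ hB) : hardySpace →ₗ[ℂ] hardySpace) := by
    rw [LinearMap.mem_ker]
    change hardySpace.orthogonalProjectionOnto (mulOp (mulConj hθ hB) g) = 0
    rw [mulOp_mulConj]
    exact Submodule.orthogonalProjectionOnto_eq_zero_iff.2 h
  rw [hker, Submodule.mem_bot] at this
  exact congrArg Subtype.val this

end Hardy

/-! ### The truncated Toeplitz operator with inner symbol -/

section TruncatedToeplitz

theorem sub_truncatedToeplitz_mem_orthogonal (θ φ : LinfT) (x : modelSpace θ) :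
    mulOp φ (x : L2T) - (truncatedToeplitz θ φ x : L2T) ∈ (modelSpace θ)ᗮ :=
  Submodule.sub_starProjection_mem_orthogonal _

theorem adjoint_truncatedToeplitz (θ φ : LinfT) :
    ContinuousLinearMap.adjoint (truncatedToeplitz θ φ) = truncatedToeplitz θ (star φ) := by
  rw [truncatedToeplitz, adjoint_compression, adjoint_mulOp, truncatedToeplitz]

/-- `A* x = P_{H²}(B̄ x)` for `A = A^θ_B`. -/
theorem sub_truncatedToeplitz_star_mem_orthogonal {θ B : LinfT} (hθ : IsInner θ) (hB : IsInner B)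
    (x : modelSpace θ) :
    mulOp (star B) (x : L2T) - (truncatedToeplitz θ (star B) x : L2T) ∈ hardySpaceᗮ := by
  set p := (hardySpace : Submodule ℂ L2T).starProjection (mulOp (star B) x) with hp
  have hk : mulOp (star B) (x : L2T) - p ∈ hardySpaceᗮ :=
    Submodule.sub_starProjection_mem_orthogonal _
  have hpm : p ∈ modelSpace θ := by
    -- `θ̄ p = B̄ (θ̄ x) - θ̄ (B̄ x - p)`, and both terms lie in `(H²)ᗮ`. So projecting `B̄ x` to
    -- `H²` already lands in `K_θ`.
    refine mem_modelSpace_iff.2 ⟨Submodule.starProjection_apply_mem _ _, ?_⟩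
    rw [← sub_sub_cancel (mulOp (star B) (x : L2T)) p, map_sub, mulOp_comm]
    exact Submodule.sub_mem _ (mulOp_star_mem_orthogonal hB (mem_modelSpace_iff.1 x.2).2)
      (mulOp_star_mem_orthogonal hθ hk)
  have : (truncatedToeplitz θ (star B) x : L2T) = p :=
    Submodule.eq_starProjection_of_mem_orthogonal hpm (orthogonal_hardySpace_le θ hk)
  rwa [this]

variable {θ B : LinfT}

theorem mulOp_star_sub_mem_modelSpace (hθ : IsInner θ) (hB : IsInner B) (x : modelSpace θ) :
    mulOp (star θ) (mulOp B (x : L2T) - (truncatedToeplitz θ B x : L2T)) ∈ modelSpace B := by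
  rw [mem_modelSpace_iff]
  constructor
  · obtain ⟨g, hg, h⟩ := exists_mulOp_eq_of_mem_orthogonal hθ
      (Submodule.sub_mem _ (mulOp_mem_hardySpace hB x.2.1) (truncatedToeplitz θ B x).2.1)
      (sub_truncatedToeplitz_mem_orthogonal θ B x)
    rwa [← h, mulOp_star_mulOp hθ]
  · rw [map_sub, map_sub, mulOp_comm (star θ) B, mulOp_star_mulOp hB]
    exact Submodule.sub_mem _ (mem_modelSpace_iff.1 x.2).2
      (mulOp_star_mem_orthogonal hB (mem_modelSpace_iff.1 (truncatedToeplitz θ B x).2).2)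

theorem sub_mulOp_mem_modelSpace (hθ : IsInner θ) (hB : IsInner B) (x : modelSpace θ) :
    (x : L2T) - mulOp B (truncatedToeplitz θ (star B) x : L2T) ∈ modelSpace B := by
  rw [mem_modelSpace_iff, map_sub, mulOp_star_mulOp hB]
  exact ⟨Submodule.sub_mem _ x.2.1
    (mulOp_mem_hardySpace hB (truncatedToeplitz θ (star B) x).2.1),
    sub_truncatedToeplitz_star_mem_orthogonal hθ hB x⟩

/-- The map `x ↦ θ̄ (B x - A x)` from `K_θ` to `K_B`. -/
noncomputable def defectMap (hθ : IsInner θ) (hB : IsInner B) : modelSpace θ →ₗ[ℂ] modelSpace B :=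
  LinearMap.codRestrict (modelSpace B)
    ((mulOp (star θ) ∘L (mulOp B ∘L (modelSpace θ).subtypeL -
      (modelSpace θ).subtypeL ∘L truncatedToeplitz θ B) : modelSpace θ →L[ℂ] L2T) :
        modelSpace θ →ₗ[ℂ] L2T)
    (mulOp_star_sub_mem_modelSpace hθ hB)

/-- The map `x ↦ x - B A* x` from `K_θ` to `K_B`. -/
noncomputable def defectMapAdjoint (hθ : IsInner θ) (hB : IsInner B) : modelSpace θ →ₗ[ℂ] modelSpace B :=
  LinearMap.codRestrict (modelSpace B)
    (((modelSpace θ).subtypeL - mulOp B ∘L (modelSpace θ).subtypeL ∘L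
      truncatedToeplitz θ (star B) : modelSpace θ →L[ℂ] L2T) : modelSpace θ →ₗ[ℂ] L2T)
    (sub_mulOp_mem_modelSpace hθ hB)

theorem coe_defectMap (hθ : IsInner θ) (hB : IsInner B) (x : modelSpace θ) :
    (defectMap hθ hB x : L2T) =
      mulOp (star θ) (mulOp B (x : L2T) - (truncatedToeplitz θ B x : L2T)) := rfl

theorem coe_defectMapAdjoint (hθ : IsInner θ) (hB : IsInner B) (x : modelSpace θ) :
    (defectMapAdjoint hθ hB x : L2T) =
      (x : L2T) - mulOp B (truncatedToeplitz θ (star B) x : L2T) := rfl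

theorem mulOp_defectMap (hθ : IsInner θ) (hB : IsInner B) (x : modelSpace θ) :
    mulOp θ (defectMap hθ hB x : L2T) =
      mulOp B (x : L2T) - (truncatedToeplitz θ B x : L2T) := by
  rw [coe_defectMap, mulOp_mulOp_star hθ]

theorem norm_sq_sub_of_inner_eq_zero {f g : L2T} (h : inner ℂ g (f - g) = 0) :
    ‖f - g‖ ^ 2 = ‖f‖ ^ 2 - ‖g‖ ^ 2 := by
  have := norm_add_sq_eq_norm_sq_add_norm_sq_of_inner_eq_zero g (f - g) h
  rw [add_sub_cancel] at this
  nlinarith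

/-- Pythagoras for `B x = A x + (B x - A x)`, as multiplication by `θ` and by `B` is isometric. -/
theorem norm_defectMap_sq (hθ : IsInner θ) (hB : IsInner B) (x : modelSpace θ) :
    ‖defectMap hθ hB x‖ ^ 2 = ‖x‖ ^ 2 - ‖truncatedToeplitz θ B x‖ ^ 2 := by
  have h := norm_sq_sub_of_inner_eq_zero ((Submodule.mem_orthogonal _ _).1
    (sub_truncatedToeplitz_mem_orthogonal θ B x) _ (truncatedToeplitz θ B x).2)
  rw [← mulOp_defectMap hθ hB, norm_mulOp_apply hθ, norm_mulOp_apply hB] at h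
  exact h

/-- Pythagoras again: `x - B A* x` is in `K_B`, hence orthogonal to `B A* x ∈ B H²`. -/
theorem norm_defectMapAdjoint_sq (hθ : IsInner θ) (hB : IsInner B) (x : modelSpace θ) :
    ‖defectMapAdjoint hθ hB x‖ ^ 2 = ‖x‖ ^ 2 - ‖truncatedToeplitz θ (star B) x‖ ^ 2 := by
  have h := norm_sq_sub_of_inner_eq_zero (f := (x : L2T))
    (g := mulOp B (truncatedToeplitz θ (star B) x : L2T)) ((Submodule.mem_orthogonal' _ _).1
      (mulOp_mem_orthogonal_modelSpace (truncatedToeplitz θ (star B) x).2.1) _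
        (sub_mulOp_mem_modelSpace hθ hB x))
  rw [norm_mulOp_apply hB] at h
  exact h

/-- If `g ∈ K_B` is orthogonal to the range, then `θ B̄ g` is orthogonal to `K_θ`, because `A x ⊥ θ
g`. This forces `T_{θB̄} g = 0`. -/
theorem orthogonal_range_defectMap (hθ : IsInner θ) (hB : IsInner B)
    (hker : LinearMap.ker (toeplitz (mulConj hθ hB) : hardySpace →ₗ[ℂ] hardySpace) = ⊥) :
    (LinearMap.range (defectMap hθ hB))ᗮ = ⊥ := by
  rw [Submodule.eq_bot_iff]
  intro g hg
  set f := mulOp θ (mulOp (star B) (g : L2T)) with hf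
  have hfK : f ∈ (modelSpace θ)ᗮ := by
    intro x hx
    have h1 := (Submodule.mem_orthogonal _ _).1 hg _ ⟨⟨x, hx⟩, rfl⟩
    change inner ℂ (defectMap hθ hB ⟨x, hx⟩ : L2T) (g : L2T) = 0 at h1
    rw [coe_defectMap, inner_mulOp_left, star_star, inner_sub_left] at h1
    have h2 : inner ℂ (truncatedToeplitz θ B ⟨x, hx⟩ : L2T) (mulOp θ (g : L2T)) = 0 :=
      (Submodule.mem_orthogonal _ _).1 (mulOp_mem_orthogonal_modelSpace g.2.1) _
        (truncatedToeplitz θ B ⟨x, hx⟩).2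
    rw [h2, sub_zero, inner_mulOp_left, mulOp_comm] at h1
    exact h1
  set p := (hardySpace : Submodule ℂ L2T).starProjection f with hp
  have hk : f - p ∈ hardySpaceᗮ := Submodule.sub_starProjection_mem_orthogonal _
  have hpH : p ∈ hardySpace := Submodule.starProjection_apply_mem _ _
  have hpK : p ∈ (modelSpace θ)ᗮ := by
    have := Submodule.sub_mem _ hfK (orthogonal_hardySpace_le θ hk)
    rwa [sub_sub_cancel] at this
  obtain ⟨h, hh, hhp⟩ := exists_mulOp_eq_of_mem_orthogonal hθ hpH hpK
  -- With `p = θ h` the inner product is that of `h ∈ H²` with `B̄ g`, which is in `(H²)ᗮ` since `g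
  -- ∈ K_B`.
  have h3 : inner ℂ p f = 0 := by
    rw [← hhp, hf, inner_mulOp_left, mulOp_star_mulOp hθ]
    exact (Submodule.mem_orthogonal _ _).1 (mem_modelSpace_iff.1 g.2).2 _ hh
  have h4 : p = 0 := by
    have h5 := (Submodule.mem_orthogonal _ _).1 hk _ hpH
    rw [inner_sub_right, h3, zero_sub, neg_eq_zero] at h5
    exact inner_self_eq_zero.1 h5
  rw [h4, sub_zero] at hk
  exact Subtype.ext (eq_zero_of_ker_toeplitz_mulConj hθ hB hker g.2.1 hk)

/-- A vector `g ∈ K_B` orthogonal to the range is orthogonal to `K_θ`, so `g = θ h` with `h ∈ H²`.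
Then `B̄ g = θ B̄ h ∈ (H²)ᗮ` says `T_{θB̄} h = 0`. -/
theorem orthogonal_range_defectMapAdjoint (hθ : IsInner θ) (hB : IsInner B)
    (hker : LinearMap.ker (toeplitz (mulConj hθ hB) : hardySpace →ₗ[ℂ] hardySpace) = ⊥) :
    (LinearMap.range (defectMapAdjoint hθ hB))ᗮ = ⊥ := by
  rw [Submodule.eq_bot_iff]
  intro g hg
  have hgK : (g : L2T) ∈ (modelSpace θ)ᗮ := by
    intro x hx
    have h1 := (Submodule.mem_orthogonal _ _).1 hg _ ⟨⟨x, hx⟩, rfl⟩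
    change inner ℂ (defectMapAdjoint hθ hB ⟨x, hx⟩ : L2T) (g : L2T) = 0 at h1
    have h2 := (Submodule.mem_orthogonal' _ _).1 (mulOp_mem_orthogonal_modelSpace
      (truncatedToeplitz θ (star B) ⟨x, hx⟩).2.1) _ g.2
    rw [coe_defectMapAdjoint, inner_sub_left, h2, sub_zero] at h1
    exact h1
  obtain ⟨h, hh, hhg⟩ := exists_mulOp_eq_of_mem_orthogonal hθ g.2.1 hgK
  have h3 := (mem_modelSpace_iff.1 g.2).2
  rw [← hhg, mulOp_comm] at h3
  refine Subtype.ext ?_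
  change (g : L2T) = 0
  rw [← hhg, eq_zero_of_ker_toeplitz_mulConj hθ hB hker hh h3, map_zero]

/-- The identity `P_{K_B}(θ g / (1 - z B̄)) = P_{K_B} u` behind the formula for the
characteristic function, where `θ g = B x - A x` and `u = (I - z A*)⁻¹ (z - A) x`. -/
theorem truncatedToeplitz_charSymbol_defectMap (hθ : IsInner θ) (hB : IsInner B) {z : ℂ}
    (hz : ‖z‖ < 1) {x u : modelSpace θ}
    (hu : u - z • truncatedToeplitz θ (star B) u = z • x - truncatedToeplitz θ B x) :
    truncatedToeplitz B (charSymbol hθ hB z hz) (defectMap hθ hB x) =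
      defectMapAdjoint hθ hB u := by
  set q := mulOp (charSymbol hθ hB z hz) (defectMap hθ hB x : L2T) with hq
  have hq1 : q - z • mulOp (star B) q =
      mulOp B (x : L2T) - (truncatedToeplitz θ B x : L2T) := by
    rw [hq, mulOp_charSymbol_sub, mulOp_defectMap]
  have hu1 : (u : L2T) - z • (truncatedToeplitz θ (star B) u : L2T) =
      z • (x : L2T) - (truncatedToeplitz θ B x : L2T) := congrArg Subtype.val hu
  -- Applying `1 - z B̄` cancels both `B x` and `A x`, since `B̄ B = 1`.
  have hr : q - u - mulOp B (x : L2T) ∈ hardySpaceᗮ := by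
    refine mem_orthogonal_of_sub_smul_mem hB hz ?_
    have : q - u - mulOp B (x : L2T) - z • mulOp (star B) (q - u - mulOp B (x : L2T)) =
        z • (mulOp (star B) (u : L2T) - (truncatedToeplitz θ (star B) u : L2T)) := by
      rw [map_sub, map_sub, mulOp_star_mulOp hB]
      linear_combination (norm := module) hq1 - hu1
    rw [this]
    exact Submodule.smul_mem _ _ (sub_truncatedToeplitz_star_mem_orthogonal hθ hB u)
  refine Subtype.ext (Submodule.eq_starProjection_of_mem_orthogonal (defectMapAdjoint hθ hB u).2 ?_)
  have : mulOp (charSymbol hθ hB z hz) (defectMap hθ hB x : L2T) -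
      (defectMapAdjoint hθ hB u : L2T) = (q - u - mulOp B (x : L2T)) +
        mulOp B ((x : L2T) + (truncatedToeplitz θ (star B) u : L2T)) := by
    rw [coe_defectMapAdjoint, map_add, ← hq]
    abel
  exact this ▸ Submodule.add_mem _ (orthogonal_hardySpace_le B hr)
    (mulOp_mem_orthogonal_modelSpace
      (Submodule.add_mem _ x.2.1 (truncatedToeplitz θ (star B) u).2.1))

end TruncatedToeplitz

set_option maxHeartbeats 1000000 in
theorem mainTheorem5 (θ B : LinfT) (hθ : IsInner θ) (hB : IsInner B)
    (hker : LinearMap.ker (toeplitz (mulConj hθ hB) : hardySpace →ₗ[ℂ] hardySpace) = ⊥) :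
    ∃ (ω : defectSpace (truncatedToeplitz θ B) ≃ₗᵢ[ℂ] modelSpace B)
      (ω' : defectSpace (ContinuousLinearMap.adjoint (truncatedToeplitz θ B)) ≃ₗᵢ[ℂ]
        modelSpace B),
      -- the two unitaries: `θ · ω(D_A x) = B x - A x` and `ω'(D_{A*} x) = x - B A* x`
      (∀ x : modelSpace θ,
        mulOp θ (ω ⟨defectOp (truncatedToeplitz θ B) x, defectOp_mem _ x⟩ : L2T) =
          mulOp B (x : L2T) - (truncatedToeplitz θ B x : L2T)) ∧
      (∀ x : modelSpace θ,
        (ω' ⟨defectOp (ContinuousLinearMap.adjoint (truncatedToeplitz θ B)) x,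
            defectOp_mem _ x⟩ : L2T) =
          (x : L2T) -
            mulOp B (ContinuousLinearMap.adjoint (truncatedToeplitz θ B) x : L2T)) ∧
      -- through them the characteristic function of `A` becomes `z ↦ A^B_{θ/(1 - z B̄)}`
      ∀ (z : ℂ) (hz : ‖z‖ < 1) (v : defectSpace (truncatedToeplitz θ B)),
        truncatedToeplitz B (charSymbol hθ hB z hz) (ω v) =
          ω' (characteristicFunction (truncatedToeplitz θ B) (norm_truncatedToeplitz_le_one θ hB) z v) := by
  have hA := norm_truncatedToeplitz_le_one θ hB
  have hA' : ‖ContinuousLinearMap.adjoint (truncatedToeplitz θ B)‖ ≤ 1 := by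
    rwa [LinearIsometryEquiv.norm_map]
  have hadj := adjoint_truncatedToeplitz θ B
  obtain ⟨ω, hω⟩ := exists_isometryEquiv_defectSpace (truncatedToeplitz θ B) hA
    (defectMap hθ hB) (norm_defectMap_sq hθ hB) (orthogonal_range_defectMap hθ hB hker)
  obtain ⟨ω', hω'⟩ := exists_isometryEquiv_defectSpace
    (ContinuousLinearMap.adjoint (truncatedToeplitz θ B)) hA' (defectMapAdjoint hθ hB)
    (fun x => by rw [hadj]; exact norm_defectMapAdjoint_sq hθ hB x)
    (orthogonal_range_defectMapAdjoint hθ hB hker)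
  refine ⟨ω, ω', fun x => ?_, fun x => ?_, fun z hz v => ?_⟩
  · rw [hω, mulOp_defectMap]
  · rw [hω', coe_defectMapAdjoint, hadj]
  -- Both sides are continuous in `v`, so it suffices to take `v = D_A x`.
  · refine (denseRange_defectOp (truncatedToeplitz θ B)).induction_on v
      (isClosed_eq (by fun_prop) (by fun_prop)) fun x => ?_
    obtain ⟨u, hu, hΘ⟩ := characteristicFunction_defectOp hA hz x
    rw [hadj] at hu
    rw [hω, hΘ, hω', truncatedToeplitz_charSymbol_defectMap hθ hB hz hu]
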